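/- **Conventions.** Work in the universe $V$ of sets of ZFC. A *structure* is a relational structure with finitely many relations; an *instance* of a structure $\mathcal D$ is a structure $\mathcal X$ of the same signature, and it is *finitely solvable* if every finite substructure of $\mathcal X$ admits a homomorphism to $\mathcal D$. The statement $K_{\mathcal D}$ says that every finitely solvable instance of $\mathcal D$ admits a homomorphism to $\mathcal D$. Let $\Gamma$ be a group. A *filter* of subgroups of $\Gamma$ is a collection $\mathcal F$ of subgroups with $\{1\}\notin\mathcal F$, $\Gamma\in\mathcal F$, closed under intersections of two members, under passing to larger subgroups of $\Gamma$, and under conjugation by elements of $\Gamma$. If $\Gamma$ acts on the universe $X$ of a structure $\mathcal X$, then $\mathrm{Stab}(\mathcal X)$ is the group of all $\gamma\in\Gamma$ with $\gamma\cdot R=R$ for every relation $R$ of $\mathcal X$ (with the coordinatewise action on tuples), and $\mathcal X$ is *$\mathcal F$-symmetric* if $\mathrm{Stab}(\mathcal X)\in\mathcal F$. A map $h:X\to D$ is *$\mathcal F$-symmetric* if $\{\gamma\in\Gamma: h(\gamma\cdot x)=h(x)\text{ for all }x\in X\}\in\mathcal F$. For $S\subset X$, $\mathrm{Stab}(S)=\{\gamma\in\Gamma:\gamma\cdot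 S=S\}$. Given $\Gamma$, $\mathcal F$ and a set $Y$ on which $\Gamma$ acts, the *permutation model* $U(\Gamma,\mathcal F,Y)$ is the following: build the cumulative hierarchy over $Y$ as a set of atoms, extend the action by $\gamma\cdot x=\{\gamma\cdot y:y\in x\}$, and let $U(\Gamma,\mathcal F,Y)$ consist of all hereditarily symmetric $x$, i.e. those for which $x$, the elements of $x$, the elements of these, and so on, all have stabilizers in $\mathcal F$. It contains (an isomorphic copy of) $V$ as its class of pure sets, and for a structure $\mathcal D$ in $V$ the statement $K_{\mathcal D}$ is interpreted in $U(\Gamma,\mathcal F,Y)$ for the copies of $\mathcal D$ among the pure sets. **Theorem.** Let $\Gamma$ be a group, $\mathcal F$ a filter of subgroups of $\Gamma$, and let $\mathcal D,\mathcal E$ be structures. Assume that the following two statements hold in $V$ (in particular, this is so if they can be proved in ZFC). 1. For every action of $\Gamma$ on the universe of a finitely solvable instance $\mathcal X$ of $\mathcal D$ such that $\mathcal X$ is $\mathcal F$-symmetric, there exists an $\mathcal F$-symmetric homomorphism from $\mathcal X$ to $\mathcal D$. 2. $\mathcal Y$ is an instance of $\mathcal E$ with an action of $\Gamma$ on its universe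 $Y$ such that $\mathcal Y$ is finitely solvable and $\mathcal F$-symmetric, $\mathrm{Stab}(S)\in\mathcal F$ for every finite $S\subset Y$, and $\mathcal Y$ admits no $\mathcal F$-symmetric homomorphism to $\mathcal E$. Then the permutation model $U(\Gamma,\mathcal F,Y)$, which depends only on $\Gamma$, $\mathcal F$ and the $\Gamma$-set $Y$, is a model of ZFA in which $K_{\mathcal D}$ holds and $K_{\mathcal E}$ fails. -/

import Mathlib

open scoped FirstOrder

universe u

/-! ### Groups, filters of subgroups, symmetric structures and homomorphisms -/

/-- A filter of subgroups of a group. -/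
structure SubgroupFilter (Γ : Type u) [Group Γ] where
  sets : Set (Subgroup Γ)
  bot_notMem : (⊥ : Subgroup Γ) ∉ sets
  top_mem : (⊤ : Subgroup Γ) ∈ sets
  inf_mem : ∀ Δ Δ' : Subgroup Γ, Δ ∈ sets → Δ' ∈ sets → Δ ⊓ Δ' ∈ sets
  mem_of_le : ∀ Δ Δ' : Subgroup Γ, Δ ∈ sets → Δ ≤ Δ' → Δ' ∈ sets
  /-- With `Δ`, the filter contains the conjugate `γ⁻¹ Δ γ`. -/
  conj_mem : ∀ (Δ : Subgroup Γ) (γ : Γ), Δ ∈ sets →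
    Δ.map (MulAut.conj γ⁻¹).toMonoidHom ∈ sets

/-- An instance `X` of `D` (a structure of the same signature) is finitely solvable if every
finite substructure of `X` admits a homomorphism to `D`. -/
def FinitelySolvable (L : FirstOrder.Language) (X D : Type u) [L.Structure X]
    [L.Structure D] : Prop :=
  ∀ S : L.Substructure X, (S : Set X).Finite → Nonempty (S →[L] D)

open scoped Pointwise in
/-- The stabilizer of a relational structure: all `γ` with `γ • R = R` for each of its relations,
where `Γ` acts coordinatewise on tuples. -/
def structStab (Γ : Type u) [Group Γ] (L : FirstOrder.Language) (X : Type u) [MulAction Γ X]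
    [L.Structure X] : Subgroup Γ :=
  ⨅ (n : ℕ) (r : L.Relations n),
    MulAction.stabilizer Γ {x : Fin n → X | FirstOrder.Language.Structure.RelMap r x}

/-- The stabilizer of a function `h : X → D`, i.e. of its graph in `X × D`, where `Γ` acts
trivially on `D`. -/
def funStab (Γ : Type u) [Group Γ] {X D : Type u} [MulAction Γ X] (h : X → D) : Subgroup Γ where
  carrier := {γ | ∀ x, h (γ • x) = h x}
  one_mem' := fun x => by rw [one_smul]
  mul_mem' := fun {a b} ha hb x => by rw [mul_smul, ha, hb]
  inv_mem' := fun {a} ha x => by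
    have := ha (a⁻¹ • x)
    rw [smul_inv_smul] at this
    exact this.symm

/-- Every finitely solvable `F`-symmetric instance of `D` has an `F`-symmetric homomorphism
to `D`. -/
def SymmetricallyCompact {Γ : Type u} [Group Γ] (F : SubgroupFilter Γ) (L : FirstOrder.Language)
    (D : Type u) [L.Structure D] : Prop :=
  ∀ (X : Type u) [MulAction Γ X] [L.Structure X],
    FinitelySolvable L X D → structStab Γ L X ∈ F.sets →
      ∃ h : X →[L] D, funStab Γ (h : X → D) ∈ F.sets

open scoped Pointwise in
/-- `Y` is a finitely solvable `F`-symmetric instance of `E` such that the setwise stabilizers of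
finite subsets of `Y` lie in `F`, and `Y` has no `F`-symmetric homomorphism to `E`. -/
structure SymmetricCounterexample {Γ : Type u} [Group Γ] (F : SubgroupFilter Γ)
    (L : FirstOrder.Language) (E Y : Type u) [L.Structure E] [MulAction Γ Y] [L.Structure Y] : Prop where
  finitelySolvable : FinitelySolvable L Y E
  symmetric : structStab Γ L Y ∈ F.sets
  stab_finite : ∀ S : Set Y, S.Finite → MulAction.stabilizer Γ S ∈ F.sets
  no_hom : ¬ ∃ h : Y →[L] E, funStab Γ (h : Y → E) ∈ F.sets

/-! ### The first-order theory ZFA -/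

/-- The symbols of the language of set theory with atoms. -/
inductive ZFARel : ℕ → Type
  | mem : ZFARel 2
  | atom : ZFARel 1

/-- The language of set theory with atoms: membership, and a predicate for being an atom. -/
def zfaLang : FirstOrder.Language.{0, 0} where
  Functions := fun _ => Empty
  Relations := ZFARel

namespace ZFA

section Internal

variable {M : Type*} [zfaLang.Structure M]

/-- Membership in the sense of `M`. -/
def Mem (x y : M) : Prop :=
  FirstOrder.Language.Structure.RelMap (L := zfaLang) ZFARel.mem ![x, y]

def IsAtom (x : M) : Prop :=
  FirstOrder.Language.Structure.RelMap (L := zfaLang) ZFARel.atom ![x]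

def IsSet (x : M) : Prop := ¬ IsAtom x

def IsEmptySet (x : M) : Prop := IsSet x ∧ ∀ y, ¬ Mem y x

def Sub (x y : M) : Prop := ∀ z, Mem z x → Mem z y

/-- `p = {a, b}`. -/
def IsUPair (p a b : M) : Prop := IsSet p ∧ ∀ z, Mem z p ↔ z = a ∨ z = b

/-- `p = (a, b) = {{a}, {a, b}}`. -/
def IsOPair (p a b : M) : Prop := ∃ s t, IsUPair s a a ∧ IsUPair t a b ∧ IsUPair p s t

/-- `p = (x₀, (x₁, (…, (xₙ₋₁, ∅))))`. -/
def IsTuple : {n : ℕ} → M → (Fin n → M) → Prop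
  | 0, p, _ => IsEmptySet p
  | _ + 1, p, x => ∃ q, IsTuple q (Fin.tail x) ∧ IsOPair p (x 0) q

/-- `s = x ∪ {x}`. -/
def IsSucc (s x : M) : Prop := IsSet s ∧ ∀ z, Mem z s ↔ Mem z x ∨ z = x

def IsInductive (I : M) : Prop :=
  (∃ e, IsEmptySet e ∧ Mem e I) ∧ ∀ x, Mem x I → ∃ s, IsSucc s x ∧ Mem s I

/-- `n` is a natural number of `M`: it lies in every inductive set of `M`. -/
def IsNat (n : M) : Prop := ∀ I, IsInductive I → Mem n I

/-- `(x, y) ∈ f`. -/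
def Maps (f x y : M) : Prop := ∃ p, Mem p f ∧ IsOPair p x y

/-- `f` is, in `M`, a function from `a` to `b`. -/
def IsFunction (f a b : M) : Prop :=
  IsSet f ∧ (∀ p, Mem p f → ∃ x y, Mem x a ∧ Mem y b ∧ IsOPair p x y) ∧
    ∀ x, Mem x a → ∃! y, Maps f x y

/-- `f` is, in `M`, a bijection from `a` to `b`. -/
def IsBijection (f a b : M) : Prop :=
  IsFunction f a b ∧ ∀ y, Mem y b → ∃! x, Maps f x y

/-- `x` is finite in the sense of `M`. -/
def IsFinite (x : M) : Prop := ∃ n f, IsNat n ∧ IsBijection f x n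

/-- `x` is a pure set: it lies in a transitive set of `M` without atoms. -/
def IsPure (x : M) : Prop :=
  ∃ t, Mem x t ∧ ∀ y, Mem y t → IsSet y ∧ Sub y t

end Internal

/-- `M` is a model of ZFA (no choice). In the two schemes `φ` runs over all first-order formulas,
with parameters `v` from `M`. -/
structure IsModel (M : Type*) [zfaLang.Structure M] : Prop where
  atom_empty : ∀ a x : M, IsAtom a → ¬ Mem x a
  set_of_atoms : ∃ A : M, IsSet A ∧ ∀ x : M, Mem x A ↔ IsAtom x
  extensionality : ∀ x y : M, IsSet x → IsSet y → (∀ z, Mem z x ↔ Mem z y) → x = y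
  pairing : ∀ a b : M, ∃ p, IsUPair p a b
  union : ∀ x : M, ∃ y, IsSet y ∧ ∀ z, Mem z y ↔ ∃ w, Mem w x ∧ Mem z w
  powerSet : ∀ x : M, ∃ y, IsSet y ∧ ∀ z, Mem z y ↔ IsSet z ∧ Sub z x
  infinity : ∃ I : M, IsSet I ∧ IsInductive I
  regularity : ∀ x : M, (∃ y, Mem y x) → ∃ y, Mem y x ∧ ∀ z, Mem z y → ¬ Mem z x
  separation : ∀ (n : ℕ) (φ : zfaLang.Formula (Fin (n + 1))) (v : Fin n → M) (x : M),
    ∃ y, IsSet y ∧ ∀ z, Mem z y ↔ Mem z x ∧ φ.Realize (Fin.cons z v : Fin (n + 1) → M)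
  replacement : ∀ (n : ℕ) (φ : zfaLang.Formula (Fin (n + 2))) (v : Fin n → M) (x : M),
    (∀ z w w' : M, Mem z x →
      φ.Realize (Fin.cons z (Fin.cons w v : Fin (n + 1) → M) : Fin (n + 2) → M) →
      φ.Realize (Fin.cons z (Fin.cons w' v : Fin (n + 1) → M) : Fin (n + 2) → M) → w = w') →
    ∃ y, IsSet y ∧ ∀ w, Mem w y ↔ ∃ z, Mem z x ∧
      φ.Realize (Fin.cons z (Fin.cons w v : Fin (n + 1) → M) : Fin (n + 2) → M)

/-! ### The compactness principle inside a model of ZFA -/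

/-- A structure, of a signature `L` with relations only, in the sense of `M`: a set of `M` and,
for each relation symbol of arity `n`, a set of `M` consisting of `n`-tuples of its elements. -/
structure InnerStructure (L : FirstOrder.Language) (M : Type*) [zfaLang.Structure M] where
  carrier : M
  rel : ∀ {n : ℕ}, L.Relations n → M
  isSet_carrier : IsSet carrier
  isSet_rel : ∀ {n : ℕ} (r : L.Relations n), IsSet (rel r)
  tuple_of_mem_rel : ∀ {n : ℕ} (r : L.Relations n) (t : M), Mem t (rel r) →
    ∃ x : Fin n → M, (∀ i, Mem (x i) carrier) ∧ IsTuple t x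

section Compactness

variable {L : FirstOrder.Language} {M : Type*} [zfaLang.Structure M]

/-- The tuple `x` is in the relation `r` of `X`. -/
def InnerStructure.Holds (X : InnerStructure L M) {n : ℕ} (r : L.Relations n)
    (x : Fin n → M) : Prop :=
  ∃ t, Mem t (X.rel r) ∧ IsTuple t x

/-- `S` is an (induced) substructure of `X`. -/
def IsSubstructure (S X : InnerStructure L M) : Prop :=
  Sub S.carrier X.carrier ∧
    ∀ {n : ℕ} (r : L.Relations n) (x : Fin n → M), (∀ i, Mem (x i) S.carrier) →
      (S.Holds r x ↔ X.Holds r x)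

/-- `h` is, in `M`, a homomorphism from `X` to `B`. -/
def IsHom (h : M) (X B : InnerStructure L M) : Prop :=
  IsFunction h X.carrier B.carrier ∧
    ∀ {n : ℕ} (r : L.Relations n) (x y : Fin n → M),
      (∀ i, Maps h (x i) (y i)) → X.Holds r x → B.Holds r y

/-- The compactness principle for `B`, in the sense of `M`: every instance of `B` all of whose
finite substructures admit a homomorphism to `B` admits a homomorphism to `B`. -/
def Compactness (B : InnerStructure L M) : Prop :=
  ∀ X : InnerStructure L M,
    (∀ S : InnerStructure L M, IsSubstructure S X → IsFinite S.carrier → ∃ h, IsHom h S B) →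
      ∃ h, IsHom h X B

/-- `B` is a copy of the structure `D` among the pure sets of `M`. -/
def IsCopy (D : Type*) [L.Structure D] (B : InnerStructure L M) : Prop :=
  IsPure B.carrier ∧ ∃ e : D ≃ {z : M // Mem z B.carrier},
    ∀ {n : ℕ} (r : L.Relations n) (x : Fin n → D),
      FirstOrder.Language.Structure.RelMap r x ↔ B.Holds r (fun i => (e (x i) : M))

end Compactness

/-- The compactness principle for `D` holds in `M`. As `D` is not literally an element of `M`, the
principle is read for the copies of `D` among the pure sets of `M`: there is one, and the
principle holds for all of them. -/
def KHolds (L : FirstOrder.Language) (D : Type*) [L.Structure D] (M : Type*)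
    [zfaLang.Structure M] : Prop :=
  (∃ B : InnerStructure L M, IsCopy D B) ∧
    ∀ B : InnerStructure L M, IsCopy D B → Compactness B

/-- The compactness principle for `D` fails in `M`: there is a copy of `D` among the pure sets of
`M`, and the principle fails for all of them. -/
def KFails (L : FirstOrder.Language) (D : Type*) [L.Structure D] (M : Type*)
    [zfaLang.Structure M] : Prop :=
  (∃ B : InnerStructure L M, IsCopy D B) ∧
    ∀ B : InnerStructure L M, IsCopy D B → ¬ Compactness B

end ZFA

/-! ### The cumulative hierarchy over a set of atoms -/

/-- Names for the elements of the cumulative hierarchy over `A`: atoms, and small families. -/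
inductive PreHier (A : Type u) : Type (u + 1)
  | atom (a : A) : PreHier A
  | family (ι : Type u) (f : ι → PreHier A) : PreHier A

namespace PreHier

variable {A : Type u}

/-- Two names denote the same object: they are the same atom, or two families with the same
members. -/
def Equiv : PreHier A → PreHier A → Prop
  | atom a, atom b => a = b
  | family _ f, family _ g => (∀ i, ∃ j, Equiv (f i) (g j)) ∧ ∀ j, ∃ i, Equiv (f i) (g j)
  | atom _, family _ _ => False
  | family _ _, atom _ => False

theorem equiv_refl (x : PreHier A) : Equiv x x := by
  induction x with
  | atom a => simp [Equiv]
  | family ι f ih => exact ⟨fun i => ⟨i, ih i⟩, fun i => ⟨i, ih i⟩⟩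

theorem equiv_symm {x y : PreHier A} (h : Equiv x y) : Equiv y x := by
  induction x generalizing y with
  | atom a => cases y with
    | atom b => exact Eq.symm h
    | family κ g => exact h.elim
  | family ι f ih => cases y with
    | atom b => exact h.elim
    | family κ g =>
      refine ⟨fun j => ?_, fun i => ?_⟩
      · obtain ⟨i, hi⟩ := h.2 j
        exact ⟨i, ih i hi⟩
      · obtain ⟨j, hj⟩ := h.1 i
        exact ⟨j, ih i hj⟩

theorem equiv_trans {x y z : PreHier A} (h : Equiv x y) (k : Equiv y z) : Equiv x z := by
  induction x generalizing y z with
  | atom a => cases y with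
    | atom b => cases z with
      | atom c => exact Eq.trans h k
      | family _ _ => exact k.elim
    | family κ g => exact h.elim
  | family ι f ih => cases y with
    | atom b => exact h.elim
    | family κ g => cases z with
      | atom c => exact k.elim
      | family l e =>
        refine ⟨fun i => ?_, fun m => ?_⟩
        · obtain ⟨j, hj⟩ := h.1 i
          obtain ⟨m, hm⟩ := k.1 j
          exact ⟨m, ih i hj hm⟩
        · obtain ⟨j, hj⟩ := k.2 m
          obtain ⟨i, hi⟩ := h.2 j
          exact ⟨i, ih i hi hj⟩

instance setoid (A : Type u) : Setoid (PreHier A) :=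
  ⟨Equiv, equiv_refl, equiv_symm, equiv_trans⟩

/-- `x` is denoted by a member of the family `y`; atoms have no members. -/
def Mem (x : PreHier A) : PreHier A → Prop
  | atom _ => False
  | family _ g => ∃ j, Equiv x (g j)

theorem mem_congr {x x' y y' : PreHier A} (hx : Equiv x x') (hy : Equiv y y') :
    Mem x y ↔ Mem x' y' := by
  cases y with
  | atom b => cases y' with
    | atom _ => exact Iff.rfl
    | family _ _ => exact hy.elim
  | family κ g => cases y' with
    | atom _ => exact hy.elim
    | family l e =>
      constructor
      · rintro ⟨j, hj⟩
        obtain ⟨m, hm⟩ := hy.1 j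
        exact ⟨m, equiv_trans (equiv_symm hx) (equiv_trans hj hm)⟩
      · rintro ⟨m, hm⟩
        obtain ⟨j, hj⟩ := hy.2 m
        exact ⟨j, equiv_trans hx (equiv_trans hm (equiv_symm hj))⟩

def IsAtom : PreHier A → Prop
  | atom _ => True
  | family _ _ => False

theorem isAtom_congr {x y : PreHier A} (h : Equiv x y) : IsAtom x ↔ IsAtom y := by
  cases x <;> cases y <;> first | exact Iff.rfl | exact h.elim

variable {Γ : Type u} [Group Γ] [MulAction Γ A]

/-- The action of `Γ` on the atoms, extended by `γ • x = {γ • y : y ∈ x}`. -/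
def act (γ : Γ) : PreHier A → PreHier A
  | atom a => atom (γ • a)
  | family ι f => family ι (fun i => act γ (f i))

theorem act_congr (γ : Γ) {x y : PreHier A} (h : Equiv x y) : Equiv (act γ x) (act γ y) := by
  induction x generalizing y with
  | atom a => cases y with
    | atom b => exact congrArg (γ • ·) h
    | family κ g => exact h.elim
  | family ι f ih => cases y with
    | atom b => exact h.elim
    | family κ g =>
      refine ⟨fun i => ?_, fun j => ?_⟩
      · obtain ⟨j, hj⟩ := h.1 i
        exact ⟨j, ih i hj⟩
      · obtain ⟨i, hi⟩ := h.2 j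
        exact ⟨i, ih i hi⟩

theorem act_one (x : PreHier A) : act (1 : Γ) x = x := by
  induction x with
  | atom a => simp [act]
  | family ι f ih => simp [act, ih]

theorem act_mul (γ δ : Γ) (x : PreHier A) : act (γ * δ) x = act γ (act δ x) := by
  induction x with
  | atom a => simp [act, mul_smul]
  | family ι f ih => simp [act, ih]

end PreHier

/-- The cumulative hierarchy over the set `A` of atoms. -/
def Hier (A : Type u) : Type (u + 1) := Quotient (PreHier.setoid A)

namespace Hier

variable {A : Type u}

def Mem (x y : Hier A) : Prop :=
  Quotient.liftOn₂ x y PreHier.Mem fun _ _ _ _ hx hy => propext (PreHier.mem_congr hx hy)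

def IsAtom (x : Hier A) : Prop :=
  Quotient.liftOn x PreHier.IsAtom fun _ _ h => propext (PreHier.isAtom_congr h)

instance instMulAction {Γ : Type u} [Group Γ] [MulAction Γ A] : MulAction Γ (Hier A) where
  smul γ := Quotient.map (PreHier.act γ) fun _ _ h => PreHier.act_congr γ h
  one_smul x := Quotient.inductionOn x fun x =>
    congrArg (Quotient.mk (PreHier.setoid A)) (PreHier.act_one x)
  mul_smul γ δ x := Quotient.inductionOn x fun x =>
    congrArg (Quotient.mk (PreHier.setoid A)) (PreHier.act_mul γ δ x)

end Hier

/-! ### The permutation model -/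

/-- `x` is hereditarily symmetric: its stabilizer is in `F`, and its elements are hereditarily
symmetric. -/
inductive HereditarilySymmetric {Γ : Type u} [Group Γ] (F : SubgroupFilter Γ) {A : Type u}
    [MulAction Γ A] : Hier A → Prop
  | intro (x : Hier A) (hx : MulAction.stabilizer Γ x ∈ F.sets)
      (hmem : ∀ y, Hier.Mem y x → HereditarilySymmetric F y) : HereditarilySymmetric F x

/-- The permutation model given by the group `Γ`, the filter `F` and the `Γ`-set `A` of atoms. -/
def PermModel {Γ : Type u} [Group Γ] (F : SubgroupFilter Γ) (A : Type u) [MulAction Γ A] :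
    Type (u + 1) :=
  {x : Hier A // HereditarilySymmetric F x}

instance PermModel.instStructure {Γ : Type u} [Group Γ] (F : SubgroupFilter Γ) (A : Type u)
    [MulAction Γ A] : zfaLang.Structure (PermModel F A) where
  funMap := fun f => Empty.elim f
  RelMap := fun r => match r with
    | ZFARel.mem => fun v => Hier.Mem (v 0).1 (v 1).1
    | ZFARel.atom => fun v => Hier.IsAtom (v 0).1

/-!
The permutation model is closed under every set-forming operation that respects symmetry: a small
set of its elements which is mapped into itself by a subgroup in the filter is the extension of an
element of the model (`PermModel.exists_isSet`). As `Γ` acts on the model by automorphisms, anything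
first-order definable from finitely many parameters is invariant under the intersection of their
stabilizers, and the axioms of ZFA follow (`PermModel.isModel`). In particular finite sets of
elements of the model belong to it, its natural numbers are the standard ones, and finiteness is
absolute (`PermModel.isFinite_iff`). Pure sets are fixed by all of `Γ`.

A function of the model between two of its sets is therefore the same as a function between their
extensions that commutes with some subgroup in the filter; for functions to a pure set this is a
symmetric function, and for functions from a finite set it is no restriction at all. This translates
the compactness principle of the model into statements about symmetric instances and symmetric
homomorphisms.

* For `D` (`PermModel.compactness_of_isCopy`): the carrier of an instance `X` in the model is
  invariant only under its own stabilizer, not under `Γ`. It is replaced by the union of the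
  `Γ`-orbits meeting it, the new elements being in no tuple of any relation. This is a symmetric,
  finitely solvable instance with an action of all of `Γ`, and a symmetric homomorphism from it
  restricts to a homomorphism of the model on `X`.
* For `E` (`PermModel.not_compactness_of_isCopy`): the set of all atoms with the relations of `Y` is
  an instance in the model, finitely solvable there since finite partial maps belong to the model,
  and a homomorphism of the model from it would give a symmetric homomorphism from `Y` to `E`.
-/

/-! ### Extensionality, smallness and regularity in the cumulative hierarchy -/

namespace Hier

variable {A : Type u} {Γ : Type u} [Group Γ] [MulAction Γ A]

/-- The atom `a`, as an element of the hierarchy. -/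
def atom (a : A) : Hier A := Quotient.mk (PreHier.setoid A) (PreHier.atom a)

theorem atom_injective : Function.Injective (atom : A → Hier A) := fun _ _ h => Quotient.exact h

theorem isAtom_iff (x : Hier A) : x.IsAtom ↔ ∃ a, atom a = x := by
  constructor
  · induction x using Quotient.inductionOn with
    | h x =>
      cases x with
      | atom a => exact fun _ => ⟨a, rfl⟩
      | family ι f => exact fun h => h.elim
  · rintro ⟨a, rfl⟩
    exact trivial

theorem not_mem_of_isAtom {x : Hier A} (hx : x.IsAtom) (y : Hier A) : ¬ Mem y x := by
  obtain ⟨a, rfl⟩ := (isAtom_iff x).1 hx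
  induction y using Quotient.inductionOn with
  | h y => exact id

theorem ext {x y : Hier A} (hx : ¬ x.IsAtom) (hy : ¬ y.IsAtom) (h : ∀ z, Mem z x ↔ Mem z y) :
    x = y := by
  induction x using Quotient.inductionOn with
  | h x =>
  induction y using Quotient.inductionOn with
  | h y =>
  cases x with
  | atom a => exact (hx trivial).elim
  | family ι f =>
  cases y with
  | atom a => exact (hy trivial).elim
  | family κ g =>
  refine Quotient.sound ⟨fun i => ?_, fun j => ?_⟩
  · exact (h (Quotient.mk _ (f i))).1 ⟨i, PreHier.equiv_refl _⟩
  · obtain ⟨i, hi⟩ := (h (Quotient.mk _ (g j))).2 ⟨j, PreHier.equiv_refl _⟩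
    exact ⟨i, PreHier.equiv_symm hi⟩

theorem exists_forall_mem_iff (s : Set (Hier A)) [Small.{u} s] :
    ∃ x : Hier A, ¬ x.IsAtom ∧ ∀ z, Mem z x ↔ z ∈ s := by
  refine ⟨Quotient.mk _ (PreHier.family (Shrink.{u} s) fun i =>
    Quotient.out ((equivShrink s).symm i).1), id, fun z => ?_⟩
  induction z using Quotient.inductionOn with
  | h z =>
  constructor
  · rintro ⟨i, hi⟩
    have : Quotient.mk _ z = ((equivShrink s).symm i).1 := by
      rw [← Quotient.out_eq ((equivShrink s).symm i).1]
      exact Quotient.sound hi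
    rw [this]
    exact ((equivShrink s).symm i).2
  · intro hz
    refine ⟨equivShrink s ⟨_, hz⟩, ?_⟩
    have : ((equivShrink s).symm (equivShrink s ⟨_, hz⟩)).1 = Quotient.mk _ z := by
      rw [Equiv.symm_apply_apply]
    exact Quotient.exact (this.symm.trans (Quotient.out_eq _).symm)

instance small_mem (x : Hier A) : Small.{u} {y | Mem y x} := by
  induction x using Quotient.inductionOn with
  | h x =>
  cases x with
  | atom a =>
    have : {y | Mem y (Quotient.mk _ (PreHier.atom a) : Hier A)} ⊆ ∅ :=
      fun y hy => not_mem_of_isAtom (x := atom a) trivial y hy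
    exact small_subset this
  | family ι f =>
    let g : ι → Hier A := fun i => Quotient.mk _ (f i)
    have : {y | Mem y (Quotient.mk _ (PreHier.family ι f) : Hier A)} ⊆ Set.range g := by
      intro y hy
      induction y using Quotient.inductionOn with
      | h y =>
      obtain ⟨i, hi⟩ := hy
      exact ⟨i, Quotient.sound (PreHier.equiv_symm hi)⟩
    exact small_subset this

theorem mem_wf : WellFounded (Mem : Hier A → Hier A → Prop) := by
  refine ⟨fun x => ?_⟩
  induction x using Quotient.inductionOn with
  | h x =>
  induction x with
  | atom a => exact ⟨_, fun y hy => (not_mem_of_isAtom (x := atom a) trivial y hy).elim⟩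
  | family ι f ih =>
    refine ⟨_, fun y hy => ?_⟩
    induction y using Quotient.inductionOn with
    | h y =>
    obtain ⟨i, hi⟩ := hy
    have : (Quotient.mk _ y : Hier A) = Quotient.mk _ (f i) := Quotient.sound hi
    rw [this]
    exact ih i

theorem isAtom_smul (γ : Γ) (x : Hier A) : (γ • x).IsAtom ↔ x.IsAtom := by
  induction x using Quotient.inductionOn with
  | h x => cases x <;> exact Iff.rfl

theorem smul_mem_smul_of_mem (γ : Γ) {x y : Hier A} (h : Mem x y) : Mem (γ • x) (γ • y) := by
  induction x using Quotient.inductionOn with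
  | h x =>
  induction y using Quotient.inductionOn with
  | h y =>
  cases y with
  | atom a => exact h.elim
  | family ι f =>
    obtain ⟨i, hi⟩ := h
    exact ⟨i, PreHier.act_congr γ hi⟩

theorem smul_mem_smul (γ : Γ) {x y : Hier A} : Mem (γ • x) (γ • y) ↔ Mem x y := by
  refine ⟨fun h => ?_, smul_mem_smul_of_mem γ⟩
  simpa only [inv_smul_smul] using smul_mem_smul_of_mem γ⁻¹ h

end Hier

/-! ### Filters of subgroups -/

namespace SubgroupFilter

variable {Γ : Type u} [Group Γ] (F : SubgroupFilter Γ)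

theorem stabilizer_smul_mem {α : Type*} [MulAction Γ α] {x : α}
    (hx : MulAction.stabilizer Γ x ∈ F.sets) (γ : Γ) :
    MulAction.stabilizer Γ (γ • x) ∈ F.sets := by
  rw [MulAction.stabilizer_smul_eq_stabilizer_map_conj]
  simpa only [inv_inv] using F.conj_mem _ γ⁻¹ hx

theorem iInf_mem {ι : Type*} [Finite ι] (Δ : ι → Subgroup Γ) (h : ∀ i, Δ i ∈ F.sets) :
    ⨅ i, Δ i ∈ F.sets := by
  have key : ∀ s : Set ι, s.Finite → ⨅ i ∈ s, Δ i ∈ F.sets := by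
    intro s hs
    induction s, hs using Set.Finite.induction_on with
    | empty => simpa using F.top_mem
    | insert _ _ ih =>
      rw [iInf_insert]
      exact F.inf_mem _ _ (h _) ih
  simpa using key Set.univ Set.finite_univ

end SubgroupFilter

/-! ### The permutation model: action, comprehension -/

namespace PermModel

open ZFA

variable {Γ : Type u} [Group Γ] {F : SubgroupFilter Γ} {A : Type u} [MulAction Γ A]

theorem stabilizer_val_mem (x : PermModel F A) : MulAction.stabilizer Γ x.1 ∈ F.sets := by
  obtain ⟨_, h, _⟩ := x.2
  exact h

theorem hereditarilySymmetric_of_mem {x : Hier A} (hx : HereditarilySymmetric F x) {y : Hier A}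
    (h : Hier.Mem y x) : HereditarilySymmetric F y := by
  obtain ⟨_, _, hmem⟩ := hx
  exact hmem y h

/-- The hereditarily symmetric elements are permuted by `Γ`, because the filter is
closed under conjugation. -/
theorem hereditarilySymmetric_smul (γ : Γ) {x : Hier A} (hx : HereditarilySymmetric F x) :
    HereditarilySymmetric F (γ • x) := by
  induction hx with
  | intro x hx _ ih =>
    refine ⟨_, F.stabilizer_smul_mem hx γ, fun y hy => ?_⟩
    rw [← smul_inv_smul γ y] at hy ⊢
    exact ih _ ((Hier.smul_mem_smul γ).1 hy)

instance instMulAction : MulAction Γ (PermModel F A) where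
  smul γ x := ⟨γ • x.1, hereditarilySymmetric_smul γ x.2⟩
  one_smul x := Subtype.ext (one_smul Γ x.1)
  mul_smul γ δ x := Subtype.ext (mul_smul γ δ x.1)

theorem stabilizer_mem (x : PermModel F A) : MulAction.stabilizer Γ x ∈ F.sets := by
  refine F.mem_of_le _ _ x.stabilizer_val_mem fun γ hγ => ?_
  exact Subtype.ext hγ

theorem smul_mem_smul (γ : Γ) {x y : PermModel F A} : Mem (γ • x) (γ • y) ↔ Mem x y :=
  Hier.smul_mem_smul γ

theorem mem_smul_iff (γ : Γ) {x y : PermModel F A} : Mem x (γ • y) ↔ Mem (γ⁻¹ • x) y := by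
  rw [← smul_mem_smul γ (x := γ⁻¹ • x), smul_inv_smul]

theorem smul_mem_of_smul_eq {γ : Γ} {x y : PermModel F A} (hγ : γ • y = y) (h : Mem x y) :
    Mem (γ • x) y := by
  rw [← hγ]
  exact (smul_mem_smul γ).2 h

theorem isSet_smul (γ : Γ) {x : PermModel F A} : IsSet (γ • x) ↔ IsSet x :=
  not_congr (Hier.isAtom_smul γ x.1)

theorem not_mem_of_isAtom {x : PermModel F A} (hx : IsAtom x) (y : PermModel F A) : ¬ Mem y x :=
  Hier.not_mem_of_isAtom hx y.1

theorem ext {x y : PermModel F A} (hx : IsSet x) (hy : IsSet y) (h : ∀ z, Mem z x ↔ Mem z y) :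
    x = y :=
  Subtype.ext <| Hier.ext hx hy fun z =>
    ⟨fun hz => (h ⟨z, hereditarilySymmetric_of_mem x.2 hz⟩).1 hz,
      fun hz => (h ⟨z, hereditarilySymmetric_of_mem y.2 hz⟩).2 hz⟩

theorem mem_wf : WellFounded (Mem : PermModel F A → PermModel F A → Prop) :=
  InvImage.wf Subtype.val Hier.mem_wf

theorem mem_irrefl (x : PermModel F A) : ¬ Mem x x := fun h =>
  mem_wf.asymmetric x x h h

instance small_mem (x : PermModel F A) : Small.{u} {y | Mem y x} :=
  small_of_injective (β := {y | Hier.Mem y x.1}) (f := fun y => ⟨y.1.1, y.2⟩) fun y z h => by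
    have h' := Subtype.ext_iff.1 h
    exact Subtype.ext (Subtype.ext h')

/-- Comprehension: a small set of elements of the model which is mapped into itself by every
element of a subgroup in the filter is the extension of a set of the model. -/
theorem exists_isSet (s : Set (PermModel F A)) [Small.{u} s] {Δ : Subgroup Γ} (hΔ : Δ ∈ F.sets)
    (h : ∀ γ ∈ Δ, ∀ x ∈ s, γ • x ∈ s) :
    ∃ x : PermModel F A, IsSet x ∧ ∀ z, Mem z x ↔ z ∈ s := by
  obtain ⟨x, hx, hmem⟩ := Hier.exists_forall_mem_iff
    ((fun y : PermModel F A => (y.1 : Hier A)) '' s)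
  have himage : ∀ γ ∈ Δ, ∀ z, Hier.Mem z x → Hier.Mem (γ • z) x := by
    intro γ hγ z hz
    obtain ⟨y, hy, rfl⟩ := (hmem z).1 hz
    exact (hmem _).2 ⟨γ • y, h γ hγ y hy, rfl⟩
  have hsymm : HereditarilySymmetric F x := by
    refine ⟨x, F.mem_of_le _ _ hΔ fun γ hγ => ?_, fun z hz => ?_⟩
    · refine Hier.ext ((Hier.isAtom_smul γ x).not.2 hx) hx fun z => ⟨fun hz => ?_, fun hz => ?_⟩
      · rw [← smul_inv_smul γ z] at hz ⊢
        exact himage γ hγ _ ((Hier.smul_mem_smul γ).1 hz)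
      · rw [← smul_inv_smul γ z]
        exact (Hier.smul_mem_smul γ).2 (himage _ (Δ.inv_mem hγ) z hz)
    · obtain ⟨y, _, rfl⟩ := (hmem z).1 hz
      exact y.2
  refine ⟨⟨x, hsymm⟩, hx, fun z => ?_⟩
  refine (hmem z.1).trans ?_
  exact ⟨fun ⟨y, hy, hyz⟩ => Subtype.ext hyz ▸ hy, fun hz => ⟨z, hz, rfl⟩⟩

/-- Finitely many elements are fixed, one by one, by a subgroup in the filter. -/
theorem exists_forall_smul_eq {s : Set (PermModel F A)} (hs : s.Finite) :
    ∃ Δ ∈ F.sets, ∀ γ ∈ Δ, ∀ x ∈ s, γ • x = x := by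
  have := hs.to_subtype
  refine ⟨_, F.iInf_mem (fun x : s => MulAction.stabilizer Γ x.1) fun x => stabilizer_mem x.1,
    fun γ hγ x hx => ?_⟩
  exact Subgroup.mem_iInf.1 hγ ⟨x, hx⟩

theorem exists_isSet_of_finite {s : Set (PermModel F A)} (hs : s.Finite) :
    ∃ x : PermModel F A, IsSet x ∧ ∀ z, Mem z x ↔ z ∈ s := by
  obtain ⟨Δ, hΔ, h⟩ := exists_forall_smul_eq hs
  have := hs.to_subtype
  have : Small.{u} s := Countable.toSmall s
  exact exists_isSet s hΔ fun γ hγ x hx => (h γ hγ x hx).symm ▸ hx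

/-! ### The permutation model satisfies ZFA -/

/-- `Γ` acts on the permutation model by automorphisms of the language of set theory. -/
def smulEquiv (γ : Γ) : PermModel F A ≃[zfaLang] PermModel F A where
  toEquiv := MulAction.toPerm γ
  map_fun' := fun f => Empty.elim f
  map_rel' := fun r v => by
    cases r with
    | mem => exact Hier.smul_mem_smul γ
    | atom => exact Hier.isAtom_smul γ _

theorem realize_smul {α : Type*} (φ : zfaLang.Formula α) (γ : Γ) (v : α → PermModel F A) :
    φ.Realize (γ • v) ↔ φ.Realize v :=
  FirstOrder.Language.StrongHomClass.realize_formula (smulEquiv γ) φ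

theorem realize_cons_smul {n : ℕ} (φ : zfaLang.Formula (Fin (n + 1))) {γ : Γ}
    {v : Fin n → PermModel F A} (hγ : γ • v = v) (x : PermModel F A) :
    φ.Realize (Fin.cons (γ • x) v : Fin (n + 1) → PermModel F A) ↔
      φ.Realize (Fin.cons x v : Fin (n + 1) → PermModel F A) := by
  rw [← realize_smul φ γ (Fin.cons x v)]
  have : γ • (Fin.cons x v : Fin (n + 1) → PermModel F A) = Fin.cons (γ • x) v := by
    funext i
    refine Fin.cases rfl (fun i => ?_) i
    exact congrFun hγ i
  rw [this]

theorem realize_cons_cons_smul {n : ℕ} (φ : zfaLang.Formula (Fin (n + 2))) {γ : Γ}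
    {v : Fin n → PermModel F A} (hγ : γ • v = v) (x y : PermModel F A) :
    φ.Realize (Fin.cons (γ • x) (Fin.cons (γ • y) v : Fin (n + 1) → PermModel F A) :
        Fin (n + 2) → PermModel F A) ↔
      φ.Realize (Fin.cons x (Fin.cons y v : Fin (n + 1) → PermModel F A) :
        Fin (n + 2) → PermModel F A) := by
  rw [← realize_smul φ γ (Fin.cons x (Fin.cons y v : Fin (n + 1) → PermModel F A))]
  have : γ • (Fin.cons x (Fin.cons y v : Fin (n + 1) → PermModel F A) :
      Fin (n + 2) → PermModel F A) =
      Fin.cons (γ • x) (Fin.cons (γ • y) v : Fin (n + 1) → PermModel F A) := by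
    funext i
    refine Fin.cases rfl (fun i => Fin.cases rfl (fun i => ?_) i) i
    exact congrFun hγ i
  rw [this]

theorem exists_forall_smul_eq_and {n : ℕ} (v : Fin n → PermModel F A) (x : PermModel F A) :
    ∃ Δ ∈ F.sets, ∀ γ ∈ Δ, γ • v = v ∧ γ • x = x := by
  obtain ⟨Δ, hΔ, h⟩ := exists_forall_smul_eq ((Set.finite_range v).insert x)
  exact ⟨Δ, hΔ, fun γ hγ => ⟨funext fun i => h γ hγ _ (Or.inr ⟨i, rfl⟩),
    h γ hγ x (Or.inl rfl)⟩⟩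

theorem exists_isUPair (a b : PermModel F A) : ∃ p, IsUPair p a b :=
  exists_isSet_of_finite (s := {a, b}) (by simp)

theorem exists_isEmptySet : ∃ e : PermModel F A, IsEmptySet e := by
  obtain ⟨e, he, h⟩ := exists_isSet_of_finite (F := F) (A := A) Set.finite_empty
  exact ⟨e, he, fun y hy => (h y).1 hy⟩

theorem exists_isSucc (x : PermModel F A) : ∃ s, IsSucc s x := by
  have : Small.{u} ({y | Mem y x} ∪ {x} : Set (PermModel F A)) := inferInstance
  refine exists_isSet ({y | Mem y x} ∪ {x}) x.stabilizer_mem fun γ hγ z hz => ?_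
  rcases hz with hz | rfl
  · exact Or.inl (smul_mem_of_smul_eq hγ hz)
  · exact Or.inr hγ

theorem isSucc_unique {s t x : PermModel F A} (hs : IsSucc s x) (ht : IsSucc t x) : s = t :=
  ext hs.1 ht.1 fun z => (hs.2 z).trans (ht.2 z).symm

/-- The empty set of the permutation model. -/
noncomputable def empty : PermModel F A := exists_isEmptySet.choose

theorem isEmptySet_empty : IsEmptySet (empty : PermModel F A) := exists_isEmptySet.choose_spec

theorem isEmptySet_iff {e : PermModel F A} : IsEmptySet e ↔ e = empty := by
  refine ⟨fun h => ext h.1 isEmptySet_empty.1 fun z => ?_, fun h => h ▸ isEmptySet_empty⟩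
  exact iff_of_false (h.2 z) (isEmptySet_empty.2 z)

/-- The von Neumann numeral `n` in the permutation model. -/
noncomputable def nat : ℕ → PermModel F A
  | 0 => empty
  | n + 1 => (exists_isSucc (nat n)).choose

theorem isSucc_nat (n : ℕ) : IsSucc (nat (n + 1) : PermModel F A) (nat n) :=
  (exists_isSucc (nat n)).choose_spec

theorem isSucc_nat_iff {n : ℕ} {s : PermModel F A} : IsSucc s (nat n) ↔ s = nat (n + 1) :=
  ⟨fun h => isSucc_unique h (isSucc_nat n), fun h => h ▸ isSucc_nat n⟩

theorem mem_nat_iff {n : ℕ} {z : PermModel F A} : Mem z (nat n) ↔ ∃ k < n, z = nat k := by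
  induction n with
  | zero => exact iff_of_false (isEmptySet_empty.2 z) (by simp)
  | succ n ih =>
    rw [(isSucc_nat n).2 z, ih]
    constructor
    · rintro (⟨k, hk, rfl⟩ | rfl)
      · exact ⟨k, by omega, rfl⟩
      · exact ⟨n, by omega, rfl⟩
    · rintro ⟨k, hk, rfl⟩
      rcases Nat.lt_succ_iff_lt_or_eq.1 hk with h | rfl
      · exact Or.inl ⟨k, h, rfl⟩
      · exact Or.inr rfl

theorem nat_injective : Function.Injective (nat : ℕ → PermModel F A) := by
  have key : ∀ m n : ℕ, m < n → (nat m : PermModel F A) ≠ nat n := fun m n hmn h =>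
    mem_irrefl (nat n) (mem_nat_iff.2 ⟨m, hmn, h.symm⟩)
  intro m n h
  by_contra hne
  rcases Nat.lt_or_gt_of_ne hne with hlt | hlt
  · exact key m n hlt h
  · exact key n m hlt h.symm

theorem smul_nat (γ : Γ) (n : ℕ) : γ • (nat n : PermModel F A) = nat n := by
  induction n using Nat.strong_induction_on with
  | _ n ih =>
  have hset : IsSet (nat n : PermModel F A) := by
    cases n with
    | zero => exact isEmptySet_empty.1
    | succ n => exact (isSucc_nat n).1
  refine ext ((isSet_smul γ).2 hset) hset fun z => ?_
  rw [mem_smul_iff, mem_nat_iff, mem_nat_iff]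
  refine exists_congr fun k => and_congr_right fun hk => ?_
  rw [inv_smul_eq_iff, ih k hk]

theorem exists_omega : ∃ I : PermModel F A, IsSet I ∧ ∀ z, Mem z I ↔ ∃ n, nat n = z := by
  have : Small.{u} (Set.range (nat : ℕ → PermModel F A)) := 
    have := (Set.countable_range (nat : ℕ → PermModel F A)).to_subtype
    Countable.toSmall _
  refine exists_isSet (Set.range nat) F.top_mem fun γ _ x hx => ?_
  obtain ⟨n, rfl⟩ := hx
  exact ⟨n, (smul_nat γ n).symm⟩

theorem isInductive_of_forall_mem_iff {I : PermModel F A} (hI : ∀ z, Mem z I ↔ ∃ n, nat n = z) :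
    IsInductive I := by
  refine ⟨⟨empty, isEmptySet_empty, (hI _).2 ⟨0, rfl⟩⟩, fun x hx => ?_⟩
  obtain ⟨n, rfl⟩ := (hI _).1 hx
  exact ⟨nat (n + 1), isSucc_nat n, (hI _).2 ⟨n + 1, rfl⟩⟩

/-- The natural numbers of the permutation model are the standard numerals. -/
theorem isNat_iff {m : PermModel F A} : IsNat m ↔ ∃ n, nat n = m := by
  constructor
  · intro h
    obtain ⟨I, _, hI⟩ := exists_omega (F := F) (A := A)
    exact (hI m).1 (h I (isInductive_of_forall_mem_iff hI))
  · rintro ⟨n, rfl⟩ I ⟨⟨e, he, heI⟩, hI⟩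
    induction n with
    | zero =>
      rw [isEmptySet_iff.1 he] at heI
      exact heI
    | succ n ih =>
      obtain ⟨s, hs, hsI⟩ := hI _ ih
      exact isSucc_nat_iff.1 hs ▸ hsI

variable (F A) in
theorem isModel : IsModel (PermModel F A) where
  atom_empty _ x ha := not_mem_of_isAtom ha x
  set_of_atoms := by
    have : Small.{u} {x : PermModel F A | IsAtom x} := by
      exact small_of_injective (β := Set.range (Hier.atom : A → Hier A))
        (f := fun x => ⟨x.1.1, (Hier.isAtom_iff x.1.1).1 x.2⟩) fun x y h => by
          have h' := Subtype.ext_iff.1 h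
          exact Subtype.ext (Subtype.ext h')
    exact exists_isSet {x | IsAtom x} F.top_mem fun γ _ x hx => (Hier.isAtom_smul γ x.1).2 hx
  extensionality _ _ := ext
  pairing := exists_isUPair
  union x := by
    have hsmall : Small.{u} (⋃ w ∈ {w | Mem w x}, {z | Mem z w} : Set (PermModel F A)) :=
      inferInstance
    obtain ⟨y, hy, h⟩ := exists_isSet (⋃ w ∈ {w | Mem w x}, {z | Mem z w}) x.stabilizer_mem
      fun γ hγ z hz => by
        simp only [Set.mem_iUnion, Set.mem_ofPred_eq, exists_prop] at hz ⊢
        obtain ⟨w, hw, hz⟩ := hz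
        exact ⟨γ • w, smul_mem_of_smul_eq hγ hw, (smul_mem_smul γ).2 hz⟩
    exact ⟨y, hy, fun z => (h z).trans (by simp)⟩
  powerSet x := by
    have : Small.{u} {z : PermModel F A | IsSet z ∧ Sub z x} :=
      small_of_injective (β := Set {y | Mem y x}) (f := fun z => {y | Mem y.1 z.1})
        fun z w hzw => Subtype.ext <| ext z.2.1 w.2.1 fun y =>
          ⟨fun hy => (Set.ext_iff.1 hzw ⟨y, z.2.2 y hy⟩).1 hy,
            fun hy => (Set.ext_iff.1 hzw ⟨y, w.2.2 y hy⟩).2 hy⟩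
    refine exists_isSet {z | IsSet z ∧ Sub z x} x.stabilizer_mem fun γ hγ z hz => ?_
    refine ⟨(isSet_smul γ).2 hz.1, fun w hw => ?_⟩
    rw [← smul_inv_smul γ w]
    exact smul_mem_of_smul_eq hγ (hz.2 _ ((mem_smul_iff γ).1 hw))
  infinity := by
    obtain ⟨I, hset, hI⟩ := exists_omega (F := F) (A := A)
    exact ⟨I, hset, isInductive_of_forall_mem_iff hI⟩
  regularity x hx := by
    obtain ⟨y, hy, hmin⟩ := mem_wf.has_min {y | Mem y x} hx
    exact ⟨y, hy, fun z hz hzx => hmin z hzx hz⟩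
  separation n φ v x := by
    obtain ⟨Δ, hΔ, h⟩ := exists_forall_smul_eq_and v x
    have : Small.{u} {z | Mem z x ∧ φ.Realize (Fin.cons z v : Fin (n + 1) → PermModel F A)} :=
      small_sep {z | Mem z x} fun z =>
        φ.Realize (Fin.cons z v : Fin (n + 1) → PermModel F A)
    exact exists_isSet {z | Mem z x ∧ φ.Realize (Fin.cons z v : Fin (n + 1) → PermModel F A)} hΔ
      fun γ hγ z hz => ⟨smul_mem_of_smul_eq (h γ hγ).2 hz.1,
        (realize_cons_smul φ (h γ hγ).1 z).2 hz.2⟩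
  replacement n φ v x huniq := by
    obtain ⟨Δ, hΔ, h⟩ := exists_forall_smul_eq_and v x
    let s : Set (PermModel F A) := {w | ∃ z, Mem z x ∧ φ.Realize
      (Fin.cons z (Fin.cons w v : Fin (n + 1) → PermModel F A) : Fin (n + 2) → PermModel F A)}
    have : Small.{u} s := by
      refine small_of_injective (β := {z | Mem z x})
        (f := fun w => ⟨w.2.choose, w.2.choose_spec.1⟩) fun w w' hw => Subtype.ext ?_
      have hz : w.2.choose = w'.2.choose := congrArg Subtype.val hw
      exact huniq _ _ _ w.2.choose_spec.1 w.2.choose_spec.2 (hz ▸ w'.2.choose_spec.2)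
    refine exists_isSet s hΔ fun γ hγ w hw => ?_
    obtain ⟨z, hz, hφ⟩ := hw
    exact ⟨γ • z, smul_mem_of_smul_eq (h γ hγ).2 hz,
      (realize_cons_cons_smul φ (h γ hγ).1 z w).2 hφ⟩

/-! ### Pairs, tuples, functions and finiteness in the permutation model -/

/-- The unordered pair `{a, b}` of the permutation model. -/
noncomputable def upair (a b : PermModel F A) : PermModel F A := (exists_isUPair a b).choose

theorem isUPair_upair (a b : PermModel F A) : IsUPair (upair a b) a b :=
  (exists_isUPair a b).choose_spec

theorem isUPair_iff {p a b : PermModel F A} : IsUPair p a b ↔ p = upair a b := by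
  refine ⟨fun h => ext h.1 (isUPair_upair a b).1 fun z => ?_, fun h => h ▸ isUPair_upair a b⟩
  exact (h.2 z).trans ((isUPair_upair a b).2 z).symm

theorem upair_eq_upair_iff {a b c d : PermModel F A} :
    upair a b = upair c d ↔ a = c ∧ b = d ∨ a = d ∧ b = c := by
  constructor
  · intro h
    have hz : ∀ z : PermModel F A, z = a ∨ z = b ↔ z = c ∨ z = d := fun z => by
      rw [← (isUPair_upair a b).2 z, h, (isUPair_upair c d).2 z]
    have ha := hz a
    have hb := hz b
    have hc := hz c
    have hd := hz d
    grind
  · rintro (⟨rfl, rfl⟩ | ⟨rfl, rfl⟩)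
    · rfl
    · exact isUPair_iff.1 ⟨(isUPair_upair a b).1, fun z =>
        ((isUPair_upair a b).2 z).trans or_comm⟩

theorem smul_upair (γ : Γ) (a b : PermModel F A) : γ • upair a b = upair (γ • a) (γ • b) := by
  refine isUPair_iff.1 ⟨(isSet_smul γ).2 (isUPair_upair a b).1, fun z => ?_⟩
  rw [mem_smul_iff, (isUPair_upair a b).2, inv_smul_eq_iff, inv_smul_eq_iff]

/-- The Kuratowski pair `(a, b)` of the permutation model. -/
noncomputable def pair (a b : PermModel F A) : PermModel F A := upair (upair a a) (upair a b)

theorem isOPair_iff {p a b : PermModel F A} : IsOPair p a b ↔ p = pair a b := by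
  simp [IsOPair, isUPair_iff, pair]

theorem pair_inj {a b c d : PermModel F A} : pair a b = pair c d ↔ a = c ∧ b = d := by
  simp only [pair, upair_eq_upair_iff]
  grind

theorem smul_pair (γ : Γ) (a b : PermModel F A) : γ • pair a b = pair (γ • a) (γ • b) := by
  simp only [pair, smul_upair]

theorem smul_empty (γ : Γ) : γ • (empty : PermModel F A) = empty := smul_nat γ 0

/-- The tuple `(x₀, (x₁, (…, ∅)))` of the permutation model. -/
noncomputable def tuple : {n : ℕ} → (Fin n → PermModel F A) → PermModel F A
  | 0, _ => empty
  | _ + 1, x => pair (x 0) (tuple (Fin.tail x))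

theorem isTuple_iff {n : ℕ} {p : PermModel F A} {x : Fin n → PermModel F A} :
    IsTuple p x ↔ p = tuple x := by
  induction n generalizing p with
  | zero => exact isEmptySet_iff
  | succ n ih => simp [IsTuple, ih, isOPair_iff, tuple]

theorem tuple_injective {n : ℕ} :
    Function.Injective (tuple : (Fin n → PermModel F A) → PermModel F A) := by
  induction n with
  | zero => exact fun x y _ => Subsingleton.elim x y
  | succ n ih =>
    intro x y h
    obtain ⟨h0, ht⟩ := pair_inj.1 h
    rw [← Fin.cons_self_tail x, ← Fin.cons_self_tail y, h0, ih ht]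

theorem smul_tuple (γ : Γ) {n : ℕ} (x : Fin n → PermModel F A) :
    γ • tuple x = tuple (γ • x) := by
  induction n with
  | zero => exact smul_empty γ
  | succ n ih =>
    change γ • pair (x 0) (tuple (Fin.tail x)) = pair (γ • x 0) (tuple (Fin.tail (γ • x)))
    rw [smul_pair, ih]
    rfl

theorem maps_iff {f x y : PermModel F A} : Maps f x y ↔ Mem (pair x y) f := by
  simp [Maps, isOPair_iff]

theorem maps_smul {γ : Γ} {f x y : PermModel F A} (hγ : γ • f = f) (h : Maps f x y) :
    Maps f (γ • x) (γ • y) := by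
  rw [maps_iff, ← smul_pair]
  exact smul_mem_of_smul_eq hγ (maps_iff.1 h)

/-- A map of sets of the model which is equivariant under a subgroup in the filter is a function
of the model. -/
theorem exists_isFunction {a b : PermModel F A} (f : PermModel F A → PermModel F A)
    (hf : ∀ x, Mem x a → Mem (f x) b) {Δ : Subgroup Γ} (hΔ : Δ ∈ F.sets)
    (h : ∀ γ ∈ Δ, ∀ x, Mem x a → Mem (γ • x) a ∧ f (γ • x) = γ • f x) :
    ∃ g, IsFunction g a b ∧ ∀ x y, Maps g x y ↔ Mem x a ∧ y = f x := by
  obtain ⟨g, hg, hmem⟩ := exists_isSet ((fun x => pair x (f x)) '' {x | Mem x a}) hΔ (by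
    rintro γ hγ _ ⟨x, hx, rfl⟩
    refine ⟨γ • x, (h γ hγ x hx).1, ?_⟩
    simp only [smul_pair, (h γ hγ x hx).2])
  have hmaps : ∀ x y, Maps g x y ↔ Mem x a ∧ y = f x := by
    intro x y
    rw [maps_iff, hmem]
    constructor
    · rintro ⟨z, hz, hzx⟩
      obtain ⟨rfl, rfl⟩ := pair_inj.1 hzx
      exact ⟨hz, rfl⟩
    · rintro ⟨hx, rfl⟩
      exact ⟨x, hx, rfl⟩
  refine ⟨g, ⟨hg, fun p hp => ?_, fun x hx => ?_⟩, hmaps⟩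
  · obtain ⟨x, hx, rfl⟩ := (hmem p).1 hp
    exact ⟨x, f x, hx, hf x hx, isOPair_iff.2 rfl⟩
  · exact ⟨f x, (hmaps x _).2 ⟨hx, rfl⟩, fun y hy => ((hmaps x y).1 hy).2⟩

theorem exists_isFunction_of_finite {a b : PermModel F A} (ha : {x | Mem x a}.Finite)
    (f : PermModel F A → PermModel F A) (hf : ∀ x, Mem x a → Mem (f x) b) :
    ∃ g, IsFunction g a b ∧ ∀ x y, Maps g x y ↔ Mem x a ∧ y = f x := by
  obtain ⟨Δ, hΔ, h⟩ := exists_forall_smul_eq (ha.union (ha.image f))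
  refine exists_isFunction f hf hΔ fun γ hγ x hx => ?_
  rw [h γ hγ x (Or.inl hx), h γ hγ (f x) (Or.inr ⟨x, hx, rfl⟩)]
  exact ⟨hx, rfl⟩

theorem mem_of_maps {f a b x y : PermModel F A} (hf : IsFunction f a b) (h : Maps f x y) :
    Mem x a ∧ Mem y b := by
  obtain ⟨x', y', hx, hy, hp⟩ := hf.2.1 _ (maps_iff.1 h)
  obtain ⟨rfl, rfl⟩ := pair_inj.1 (isOPair_iff.1 hp)
  exact ⟨hx, hy⟩

theorem exists_fun_of_isFunction {f a b : PermModel F A} (hf : IsFunction f a b) :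
    ∃ g : PermModel F A → PermModel F A, ∀ x, Mem x a → ∀ y, Maps f x y ↔ y = g x := by
  classical
  refine ⟨fun x => if hx : Mem x a then (hf.2.2 x hx).choose else x, fun x hx y => ?_⟩
  simp only [dif_pos hx]
  have hspec := (hf.2.2 x hx).choose_spec
  exact ⟨fun h => hspec.2 y h, fun h => h ▸ hspec.1⟩

/-- Being finite is absolute for the permutation model. -/
theorem isFinite_iff {x : PermModel F A} : IsFinite x ↔ {y | Mem y x}.Finite := by
  constructor
  · rintro ⟨m, f, hm, hf, hbij⟩
    obtain ⟨n, rfl⟩ := isNat_iff.1 hm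
    obtain ⟨g, hg⟩ := exists_fun_of_isFunction hf
    have hnat : {z : PermModel F A | Mem z (nat n)}.Finite := by
      refine ((Set.finite_Iio n).image nat).subset fun z hz => ?_
      obtain ⟨k, hk, rfl⟩ := mem_nat_iff.1 hz
      exact ⟨k, hk, rfl⟩
    refine Set.Finite.of_finite_image (f := g) (hnat.subset ?_) ?_
    · rintro _ ⟨y, hy, rfl⟩
      exact (mem_of_maps hf ((hg y hy _).2 rfl)).2
    · intro y hy z hz hyz
      have hmy := (hg y hy _).2 rfl
      exact (hbij _ (mem_of_maps hf hmy).2).unique hmy ((hg z hz _).2 hyz)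
  · intro hx
    classical
    have := hx.to_subtype
    obtain ⟨n, ⟨e⟩⟩ := Finite.exists_equiv_fin {y | Mem y x}
    let g : PermModel F A → PermModel F A := fun y =>
      if hy : Mem y x then nat (e ⟨y, hy⟩) else y
    have hg : ∀ y (hy : Mem y x), g y = nat (e ⟨y, hy⟩) := fun y hy => dif_pos hy
    obtain ⟨f, hf, hmaps⟩ := exists_isFunction_of_finite (b := nat n) hx g fun y hy => by
      rw [hg y hy]
      exact mem_nat_iff.2 ⟨_, (e ⟨y, hy⟩).2, rfl⟩
    refine ⟨nat n, f, isNat_iff.2 ⟨n, rfl⟩, hf, fun z hz => ?_⟩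
    obtain ⟨k, hk, rfl⟩ := mem_nat_iff.1 hz
    obtain ⟨⟨y, hy⟩, hey⟩ := e.surjective ⟨k, hk⟩
    refine ⟨y, (hmaps y _).2 ⟨hy, ?_⟩, fun y' hy' => ?_⟩
    · rw [hg y hy, hey]
    · obtain ⟨hy', hk'⟩ := (hmaps y' _).1 hy'
      rw [hg y' hy'] at hk'
      have : e ⟨y', hy'⟩ = e ⟨y, hy⟩ := by
        rw [hey]
        exact Fin.ext (nat_injective hk').symm
      exact congrArg Subtype.val (e.injective this)

/-! ### Structures and homomorphisms in the permutation model -/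

section Structures

variable {L : FirstOrder.Language}

theorem holds_iff {X : InnerStructure L (PermModel F A)} {n : ℕ} {r : L.Relations n}
    {x : Fin n → PermModel F A} : X.Holds r x ↔ Mem (tuple x) (X.rel r) := by
  simp [InnerStructure.Holds, isTuple_iff]

theorem mem_carrier_of_holds {X : InnerStructure L (PermModel F A)} {n : ℕ} {r : L.Relations n}
    {x : Fin n → PermModel F A} (h : X.Holds r x) (i : Fin n) : Mem (x i) X.carrier := by
  obtain ⟨y, hy, hty⟩ := X.tuple_of_mem_rel r _ (holds_iff.1 h)
  rw [tuple_injective (isTuple_iff.1 hty)]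
  exact hy i

theorem holds_smul_iff {X : InnerStructure L (PermModel F A)} {n : ℕ} {r : L.Relations n}
    {γ : Γ} (hγ : γ • X.rel r = X.rel r) (x : Fin n → PermModel F A) :
    X.Holds r (γ • x) ↔ X.Holds r x := by
  rw [holds_iff, holds_iff, ← smul_tuple, ← smul_mem_smul γ (x := tuple x), hγ]

/-- A set of the model together with small, suitably invariant sets of tuples of its elements is a
structure of the model. -/
theorem exists_innerStructure (a : PermModel F A) (ha : IsSet a)
    (R : ∀ {n : ℕ}, L.Relations n → (Fin n → PermModel F A) → Prop)
    (hR : ∀ {n : ℕ} (r : L.Relations n) (x : Fin n → PermModel F A), R r x → ∀ i, Mem (x i) a)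
    (hsymm : ∀ {n : ℕ} (r : L.Relations n), ∃ Δ ∈ F.sets, ∀ γ ∈ Δ, ∀ x, R r x → R r (γ • x)) :
    ∃ X : InnerStructure L (PermModel F A), X.carrier = a ∧
      ∀ {n : ℕ} (r : L.Relations n) (x : Fin n → PermModel F A), X.Holds r x ↔ R r x := by
  have key : ∀ {n : ℕ} (r : L.Relations n), ∃ p : PermModel F A, IsSet p ∧
      ∀ z, Mem z p ↔ z ∈ tuple '' {x : Fin n → PermModel F A | R r x} := by
    intro n r
    obtain ⟨Δ, hΔ, h⟩ := hsymm r
    have : Small.{u} {x : Fin n → PermModel F A | R r x} := by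
      refine small_of_injective (β := Fin n → {y | Mem y a})
        (f := fun x i => ⟨x.1 i, hR r x.1 x.2 i⟩) fun x y hxy => Subtype.ext (funext fun i => ?_)
      exact Subtype.ext_iff.1 (congrFun hxy i)
    refine exists_isSet _ hΔ ?_
    rintro γ hγ _ ⟨x, hx, rfl⟩
    exact ⟨γ • x, h γ hγ x hx, (smul_tuple γ x).symm⟩
  choose rel hrel hmem using @key
  refine ⟨⟨a, rel, ha, hrel, fun r t ht => ?_⟩, rfl, fun r x => ?_⟩
  · obtain ⟨x, hx, rfl⟩ := (hmem r t).1 ht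
    exact ⟨x, hR r x hx, isTuple_iff.2 rfl⟩
  · rw [holds_iff]
    refine (hmem r _).trans ⟨?_, fun hx => ⟨x, hx, rfl⟩⟩
    rintro ⟨y, hy, hyx⟩
    exact tuple_injective hyx ▸ hy

theorem exists_isSubstructure (X : InnerStructure L (PermModel F A)) {s : Set (PermModel F A)}
    (hs : s.Finite) (hsX : ∀ x ∈ s, Mem x X.carrier) :
    ∃ S : InnerStructure L (PermModel F A), IsSubstructure S X ∧ ∀ x, Mem x S.carrier ↔ x ∈ s := by
  obtain ⟨a, ha, hmem⟩ := exists_isSet_of_finite hs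
  obtain ⟨S, rfl, hS⟩ := exists_innerStructure (L := L) a ha
    (fun r x => (∀ i, x i ∈ s) ∧ X.Holds r x) (fun r x hx i => (hmem _).2 (hx.1 i)) fun r => by
      obtain ⟨Δ, hΔ, h⟩ := exists_forall_smul_eq (hs.insert (X.rel r))
      refine ⟨Δ, hΔ, fun γ hγ x hx => ⟨fun i => ?_,
        (holds_smul_iff (h γ hγ _ (Or.inl rfl)) x).2 hx.2⟩⟩
      have : γ • x i = x i := h γ hγ _ (Or.inr (hx.1 i))
      change γ • x i ∈ s
      rw [this]
      exact hx.1 i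
  refine ⟨S, ⟨fun z hz => hsX z ((hmem z).1 hz), fun r x hx => ?_⟩, hmem⟩
  exact (hS r x).trans (and_iff_right fun i => (hmem _).1 (hx i))

theorem isHom_of_maps_iff {X B : InnerStructure L (PermModel F A)} {g : PermModel F A}
    (hg : IsFunction g X.carrier B.carrier) {f : PermModel F A → PermModel F A}
    (hmaps : ∀ x y, Maps g x y ↔ Mem x X.carrier ∧ y = f x)
    (hrel : ∀ {n : ℕ} (r : L.Relations n) (x : Fin n → PermModel F A), X.Holds r x →
      B.Holds r fun i => f (x i)) : IsHom g X B := by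
  refine ⟨hg, fun r x y hxy hx => ?_⟩
  obtain rfl : y = fun i => f (x i) := funext fun i => ((hmaps _ _).1 (hxy i)).2
  exact hrel r x hx

/-- A homomorphism of the model is a map preserving the relations. It commutes with the
stabilizer of its graph. -/
theorem exists_fun_of_isHom {X B : InnerStructure L (PermModel F A)} {g : PermModel F A}
    (hg : IsHom g X B) : ∃ f : PermModel F A → PermModel F A,
      (∀ x, Mem x X.carrier → Mem (f x) B.carrier) ∧
      (∀ {n : ℕ} (r : L.Relations n) (x : Fin n → PermModel F A), X.Holds r x →
        B.Holds r fun i => f (x i)) ∧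
      ∀ γ : Γ, γ • g = g → ∀ x, Mem x X.carrier → f (γ • x) = γ • f x := by
  obtain ⟨f, hf⟩ := exists_fun_of_isFunction hg.1
  refine ⟨f, fun x hx => (mem_of_maps hg.1 ((hf x hx _).2 rfl)).2, fun r x hx => ?_,
    fun γ hγ x hx => ?_⟩
  · exact hg.2 r x _ (fun i => (hf _ (mem_carrier_of_holds hx i) _).2 rfl) hx
  · have h := maps_smul hγ ((hf x hx _).2 rfl)
    exact ((hf _ (mem_of_maps hg.1 h).1 _).1 h).symm

/-! ### Pure sets and the copies of a structure -/

/-- Pure sets are fixed by `Γ`. -/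
theorem smul_eq_of_isPure {x : PermModel F A} (hx : IsPure x) (γ : Γ) : γ • x = x := by
  obtain ⟨t, hxt, ht⟩ := hx
  induction x using mem_wf.induction generalizing γ with
  | _ x ih =>
  have hset := (ht x hxt).1
  refine ext ((isSet_smul γ).2 hset) hset fun z => ⟨fun hz => ?_, fun hz => ?_⟩
  · have hz' := (mem_smul_iff γ).1 hz
    have h := ih _ hz' γ ((ht x hxt).2 _ hz')
    rw [smul_inv_smul] at h
    rwa [h]
  · rw [mem_smul_iff, ih z hz γ⁻¹ ((ht x hxt).2 z hz)]
    exact hz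

theorem isPure_of_mem {x y : PermModel F A} (hy : IsPure y) (h : Mem x y) : IsPure x := by
  obtain ⟨t, hyt, ht⟩ := hy
  exact ⟨t, (ht y hyt).2 x h, ht⟩

theorem exists_isSet_range {ι : Type u} (f : ι → PermModel F A)
    (hf : ∀ i (γ : Γ), γ • f i = f i) :
    ∃ x : PermModel F A, IsSet x ∧ ∀ z, Mem z x ↔ ∃ i, f i = z := by
  refine exists_isSet (Set.range f) F.top_mem ?_
  rintro γ - _ ⟨i, rfl⟩
  exact ⟨i, (hf i γ).symm⟩

/-- Along a well-order of an index set, the von Neumann ordinals give pairwise different pure sets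
of the model. -/
theorem exists_injective_pure (A : Type u) [MulAction Γ A] (D : Type u) :
    ∃ c : D → PermModel F A, Function.Injective c ∧ (∀ d (γ : Γ), γ • c d = c d) ∧
      ∀ d, IsSet (c d) ∧ ∀ z, Mem z (c d) → ∃ d', c d' = z := by
  have hwf : WellFounded (WellOrderingRel : D → D → Prop) := IsWellFounded.wf
  let P := {x : PermModel F A // ∀ γ : Γ, γ • x = x}
  have key : ∀ {ι : Type u} (f : ι → P), ∃ x : P, IsSet x.1 ∧ ∀ z, Mem z x.1 ↔ ∃ i, (f i).1 = z := by
    intro ι f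
    obtain ⟨x, hx, hmem⟩ := exists_isSet_range (fun i => (f i).1) fun i => (f i).2
    refine ⟨⟨x, fun γ => ext ((isSet_smul γ).2 hx) hx fun z => ?_⟩, hx, hmem⟩
    rw [mem_smul_iff, hmem, hmem]
    refine exists_congr fun i => ?_
    rw [eq_inv_smul_iff, (f i).2]
  choose mk hset hmem using @key
  let c : D → P := hwf.fix fun d ih => mk fun d' : {d' // WellOrderingRel d' d} => ih d'.1 d'.2
  have hc : ∀ d, c d = mk fun d' : {d' // WellOrderingRel d' d} => c d'.1 := fun d =>
    hwf.fix_eq _ d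
  have hcmem : ∀ d z, Mem z (c d).1 ↔ ∃ d', WellOrderingRel d' d ∧ (c d').1 = z := by
    intro d z
    rw [hc d, hmem]
    simp
  have hne : ∀ d d', WellOrderingRel d d' → (c d).1 ≠ (c d').1 := fun d d' hlt h =>
    mem_irrefl _ ((hcmem d' _).2 ⟨d, hlt, h⟩)
  refine ⟨fun d => (c d).1, fun d d' h => ?_, fun d => (c d).2, fun d => ⟨?_, fun z hz => ?_⟩⟩
  · rcases trichotomous_of WellOrderingRel d d' with hlt | heq | hlt
    · exact (hne d d' hlt h).elim
    · exact heq
    · exact (hne d' d hlt h.symm).elim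
  · change IsSet (c d).1
    rw [hc d]
    exact hset _
  · obtain ⟨d', _, h⟩ := (hcmem d z).1 hz
    exact ⟨d', h⟩

variable (F A L) in
/-- Every structure has a copy among the pure sets of the model. -/
theorem exists_isCopy (D : Type u) [L.Structure D] :
    ∃ B : InnerStructure L (PermModel F A), IsCopy D B := by
  obtain ⟨c, hinj, hfix, hc⟩ := exists_injective_pure (F := F) A D
  obtain ⟨a, ha, hmem⟩ := exists_isSet_range c hfix
  obtain ⟨B, rfl, hB⟩ := exists_innerStructure (L := L) a ha
    (fun r x => ∃ d, FirstOrder.Language.Structure.RelMap r d ∧ x = fun i => c (d i))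
    (by
      rintro n r _ ⟨d, _, rfl⟩ i
      exact (hmem _).2 ⟨d i, rfl⟩)
    fun r => ⟨⊤, F.top_mem, by
      rintro γ - _ ⟨d, hd, rfl⟩
      exact ⟨d, hd, funext fun i => hfix (d i) γ⟩⟩
  have hafix : ∀ γ : Γ, γ • B.carrier = B.carrier := fun γ =>
    ext ((isSet_smul γ).2 ha) ha fun z => by
      rw [mem_smul_iff, hmem, hmem]
      refine exists_congr fun d => ?_
      rw [eq_inv_smul_iff, hfix]
  refine ⟨B, ?_, Equiv.ofBijective (fun d => ⟨c d, (hmem _).2 ⟨d, rfl⟩⟩) ⟨?_, ?_⟩, ?_⟩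
  · -- The carrier together with its elements forms a transitive set without atoms.
    obtain ⟨t, _, ht⟩ := exists_isSet_range (fun o : Option D => o.elim B.carrier c) (by
      rintro (_ | d) γ
      · exact hafix γ
      · exact hfix d γ)
    refine ⟨t, (ht _).2 ⟨none, rfl⟩, fun y hy => ?_⟩
    obtain ⟨_ | d, rfl⟩ := (ht y).1 hy
    · refine ⟨ha, fun z hz => ?_⟩
      obtain ⟨d, rfl⟩ := (hmem z).1 hz
      exact (ht _).2 ⟨some d, rfl⟩
    · refine ⟨(hc d).1, fun z hz => ?_⟩
      obtain ⟨d', rfl⟩ := (hc d).2 z hz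
      exact (ht _).2 ⟨some d', rfl⟩
  · exact fun d d' h => hinj (Subtype.ext_iff.1 h)
  · rintro ⟨z, hz⟩
    obtain ⟨d, rfl⟩ := (hmem z).1 hz
    exact ⟨d, rfl⟩
  · intro n r x
    refine Iff.trans ⟨fun h => ⟨x, h, rfl⟩, ?_⟩ (hB r _).symm
    rintro ⟨d, hd, hxd⟩
    have : x = d := funext fun i => hinj (congrFun hxd i)
    rwa [this]

end Structures

open FirstOrder.Language.Structure

variable {L : FirstOrder.Language}

/-! ### Transfer of the compactness principle -/

/-- The union of the orbits that meet a set `a` of the model is, up to bijection, a `Γ`-set in the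
universe `u`. It replaces `a` itself, which is stable only under its own stabilizer. -/
theorem exists_orbit_closure (a : PermModel F A) :
    ∃ (T : Type u) (_ : MulAction Γ T) (ι : T → PermModel F A), Function.Injective ι ∧
      (∀ (γ : Γ) (t : T), ι (γ • t) = γ • ι t) ∧ (∀ t, ∃ γ : Γ, Mem (γ • ι t) a) ∧
      ∀ x, Mem x a → ∃ t, ι t = x := by
  let s : SubMulAction Γ (PermModel F A) :=
    { carrier := ⋃ γ : Γ, (γ • ·) '' {x | Mem x a}
      smul_mem' := by
        intro γ x hx
        obtain ⟨δ, y, hy, rfl⟩ := Set.mem_iUnion.1 hx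
        exact Set.mem_iUnion.2 ⟨γ * δ, y, hy, mul_smul γ δ y⟩ }
  have : Small.{u} s :=
    inferInstanceAs (Small.{u} (⋃ γ : Γ, (γ • ·) '' {x | Mem x a} : Set (PermModel F A)))
  refine ⟨Shrink.{u} s, (equivShrink s).symm.mulAction Γ, fun t => ((equivShrink s).symm t).1,
    Subtype.val_injective.comp (equivShrink s).symm.injective, fun γ t => ?_, fun t => ?_,
    fun x hx => ⟨equivShrink s ⟨x, Set.mem_iUnion.2 ⟨1, x, hx, one_smul Γ x⟩⟩, ?_⟩⟩
  · let := (equivShrink s).symm.mulAction Γ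
    change ((equivShrink s).symm (equivShrink s (γ • (equivShrink s).symm t))).1 = _
    rw [Equiv.symm_apply_apply]
    rfl
  · obtain ⟨γ, y, hy, hyt⟩ := Set.mem_iUnion.1 ((equivShrink s).symm t).2
    refine ⟨γ⁻¹, ?_⟩
    change Mem (γ⁻¹ • ((equivShrink s).symm t).1) a
    rw [← hyt]
    change Mem (γ⁻¹ • γ • y) a
    rw [inv_smul_smul]
    exact hy
  · simp only [Equiv.symm_apply_apply]

/-- If every relation of an external structure `T` is the trace of a relation of a structure `X` of
the model along an equivariant map, then `T` is as symmetric as `X`. -/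
theorem structStab_mem [Finite (Σ n, L.Relations n)] {T : Type u} [MulAction Γ T] [L.Structure T]
    {ι : T → PermModel F A} (hι : ∀ (γ : Γ) (t : T), ι (γ • t) = γ • ι t)
    (X : InnerStructure L (PermModel F A))
    (hX : ∀ {n : ℕ} (r : L.Relations n) (t : Fin n → T),
      RelMap r t ↔ X.Holds r fun i => ι (t i)) : structStab Γ L T ∈ F.sets := by
  refine F.mem_of_le _ _ (F.iInf_mem (fun r : Σ n, L.Relations n =>
    MulAction.stabilizer Γ (X.rel r.2)) fun r => stabilizer_mem _) fun γ hγ => ?_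
  refine Subgroup.mem_iInf.2 fun n => Subgroup.mem_iInf.2 fun r =>
    MulAction.mem_stabilizer_set.2 fun t => ?_
  refine (hX r (γ • t)).trans (Iff.trans ?_ (hX r t).symm)
  have : (fun i => ι ((γ • t) i)) = γ • fun i => ι (t i) := funext fun i => hι γ (t i)
  rw [this]
  exact holds_smul_iff (Subgroup.mem_iInf.1 hγ ⟨n, r⟩) _

theorem compactness_of_isCopy [L.IsRelational] [Finite (Σ n, L.Relations n)] {D : Type u}
    [L.Structure D] (hD : SymmetricallyCompact F L D) {B : InnerStructure L (PermModel F A)}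
    (hB : IsCopy D B) : Compactness B := by
  classical
  obtain ⟨hpure, e, he⟩ := hB
  have hfix : ∀ (γ : Γ) (d : D), γ • (e d).1 = (e d).1 := fun γ d =>
    smul_eq_of_isPure (isPure_of_mem hpure (e d).2) γ
  intro X hX
  -- A finite set of elements of `X` carries a relation-preserving map to the copy `B`.
  have hfin : ∀ s : Set (PermModel F A), s.Finite → (∀ x ∈ s, Mem x X.carrier) →
      ∃ f : PermModel F A → PermModel F A, (∀ x ∈ s, Mem (f x) B.carrier) ∧
        ∀ {n : ℕ} (r : L.Relations n) (x : Fin n → PermModel F A), (∀ i, x i ∈ s) →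
          X.Holds r x → B.Holds r fun i => f (x i) := by
    intro s hs hsX
    obtain ⟨S, hS, hmem⟩ := exists_isSubstructure X hs hsX
    obtain ⟨g, hg⟩ := hX S hS (isFinite_iff.2 (hs.subset fun x hx => (hmem x).1 hx))
    obtain ⟨f, hf, hrel, -⟩ := exists_fun_of_isHom hg
    exact ⟨f, fun x hx => hf x ((hmem x).2 hx), fun r x hx hr =>
      hrel r x ((hS.2 r x fun i => (hmem _).2 (hx i)).2 hr)⟩
  obtain ⟨T, _, ι, hinj, hι, horbit, hsurj⟩ := exists_orbit_closure X.carrier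
  let : L.Structure T :=
    { funMap := fun f => isEmptyElim f
      RelMap := fun r t => X.Holds r fun i => ι (t i) }
  have hne : T → Nonempty D := fun t => by
    obtain ⟨γ, hγ⟩ := horbit t
    obtain ⟨f, hf, -⟩ := hfin {γ • ι t} (Set.finite_singleton _) (by rintro _ rfl; exact hγ)
    exact ⟨e.symm ⟨_, hf _ rfl⟩⟩
  have hsolv : FinitelySolvable L T D := by
    intro S hS
    -- Elements of `T` outside `X` lie in no tuple of a relation, so their images are arbitrary.
    obtain ⟨f, hf, hrel⟩ := hfin (ι '' S ∩ {x | Mem x X.carrier}) ((hS.image ι).inter_of_left _)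
      fun x hx => hx.2
    let g : S → D := fun t => if ht : Mem (ι t.1) X.carrier then
      e.symm ⟨f (ι t.1), hf _ ⟨⟨t.1, t.2, rfl⟩, ht⟩⟩ else (hne t.1).some
    have hg : ∀ t : S, Mem (ι t.1) X.carrier → (e (g t)).1 = f (ι t.1) := by
      intro t ht
      simp only [g, dif_pos ht, Equiv.apply_symm_apply]
    refine ⟨⟨g, fun f => isEmptyElim f, fun {n} r t ht => ?_⟩⟩
    have ht' : X.Holds r fun i => ι (t i).1 := ht
    have hmem := mem_carrier_of_holds ht'
    refine (he r _).2 ?_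
    have := hrel r _ (fun i => ⟨⟨_, (t i).2, rfl⟩, hmem i⟩) ht'
    rwa [show (fun i => (e ((g ∘ t) i)).1) = fun i => f (ι (t i).1) from
      funext fun i => hg _ (hmem i)]
  obtain ⟨h, hh⟩ := hD T hsolv (structStab_mem hι X fun _ _ => Iff.rfl)
  let f : PermModel F A → PermModel F A :=
    Function.extend ι (fun t => (e (h t)).1) fun _ => empty
  have hf : ∀ t, f (ι t) = (e (h t)).1 := fun t => hinj.extend_apply _ _ t
  obtain ⟨g, hg, hmaps⟩ := exists_isFunction (a := X.carrier) (b := B.carrier) f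
    (fun x hx => by
      obtain ⟨t, rfl⟩ := hsurj x hx
      rw [hf]
      exact (e (h t)).2)
    (F.inf_mem _ _ X.carrier.stabilizer_mem hh) (fun γ hγ x hx => by
      refine ⟨smul_mem_of_smul_eq hγ.1 hx, ?_⟩
      obtain ⟨t, rfl⟩ := hsurj x hx
      rw [← hι, hf, hf, hfix, hγ.2 t])
  refine ⟨g, isHom_of_maps_iff hg hmaps fun r x hx => ?_⟩
  choose t ht using fun i => hsurj _ (mem_carrier_of_holds hx i)
  obtain rfl : (fun i => ι (t i)) = x := funext ht
  have := (he r _).1 (h.map_rel r t hx)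
  simpa only [hf, Function.comp_apply] using this

/-- The symmetric counterexample, realized by the atoms themselves, refutes the compactness
principle in the permutation model over its universe. -/
theorem not_compactness_of_isCopy [L.IsRelational] [Finite (Σ n, L.Relations n)] {E Y : Type u}
    [MulAction Γ Y] [L.Structure Y] [L.Structure E] (hE : SymmetricCounterexample F L E Y)
    {B : InnerStructure L (PermModel F Y)} (hB : IsCopy E B) : ¬ Compactness B := by
  classical
  obtain ⟨hpure, e, he⟩ := hB
  intro hcomp
  have hatom : ∀ y : Y, MulAction.stabilizer Γ (Hier.atom y) ∈ F.sets := by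
    intro y
    refine F.mem_of_le _ _ (hE.stab_finite {y} (Set.finite_singleton y)) fun γ hγ => ?_
    rw [MulAction.stabilizer_singleton] at hγ
    exact congrArg Hier.atom hγ
  let ι : Y → PermModel F Y := fun y =>
    ⟨Hier.atom y, _, hatom y, fun z hz =>
      (Hier.not_mem_of_isAtom (x := Hier.atom y) trivial z hz).elim⟩
  have hinj : Function.Injective ι := fun y z h => Hier.atom_injective (Subtype.ext_iff.1 h)
  have hι : ∀ (γ : Γ) (y : Y), ι (γ • y) = γ • ι y := fun _ _ => rfl
  obtain ⟨a, ha, hmem⟩ := exists_isSet (Set.range ι) F.top_mem (by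
    rintro γ - _ ⟨y, rfl⟩
    exact ⟨γ • y, hι γ y⟩)
  obtain ⟨X, rfl, hX⟩ := exists_innerStructure (L := L) a ha
    (fun r x => ∃ y, RelMap r y ∧ x = fun i => ι (y i))
    (by
      rintro n r _ ⟨y, -, rfl⟩ i
      exact (hmem _).2 ⟨y i, rfl⟩)
    fun {n} r => ⟨_, hE.symmetric, by
      rintro γ hγ _ ⟨y, hy, rfl⟩
      have hγ' := Subgroup.mem_iInf.1 (Subgroup.mem_iInf.1 hγ n) r
      exact ⟨γ • y, (MulAction.mem_stabilizer_set.1 hγ' y).2 hy, rfl⟩⟩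
  have hXι : ∀ {n : ℕ} (r : L.Relations n) (y : Fin n → Y),
      X.Holds r (fun i => ι (y i)) ↔ RelMap r y := by
    intro n r y
    refine (hX r _).trans ⟨?_, fun h => ⟨y, h, rfl⟩⟩
    rintro ⟨z, hz, hyz⟩
    have : y = z := funext fun i => hinj (congrFun hyz i)
    rwa [this]
  obtain ⟨g, hg⟩ := hcomp X (by
    intro S hS hfin
    let S' : L.Substructure Y :=
      { carrier := {y | Mem (ι y) S.carrier}
        fun_mem := fun f => isEmptyElim f }
    have hS' : (S' : Set Y).Finite :=
      Set.Finite.preimage (f := ι) hinj.injOn (isFinite_iff.1 hfin)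
    obtain ⟨h⟩ := hE.finitelySolvable S' hS'
    let f : PermModel F Y → PermModel F Y :=
      Function.extend (fun y : S' => ι y.1) (fun y => (e (h y)).1) fun _ => empty
    have hf : ∀ y : S', f (ι y.1) = (e (h y)).1 := fun y =>
      (hinj.comp Subtype.val_injective).extend_apply _ _ y
    have hsurj : ∀ x, Mem x S.carrier → ∃ y : S', ι y.1 = x := by
      intro x hx
      obtain ⟨y, rfl⟩ := (hmem x).1 (hS.1 x hx)
      exact ⟨⟨y, hx⟩, rfl⟩
    obtain ⟨g, hg, hmaps⟩ := exists_isFunction_of_finite (b := B.carrier) (isFinite_iff.1 hfin) f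
      fun x hx => by
        obtain ⟨y, rfl⟩ := hsurj x hx
        rw [hf]
        exact (e (h y)).2
    refine ⟨g, isHom_of_maps_iff hg hmaps fun r x hx => ?_⟩
    have hxS := mem_carrier_of_holds hx
    have hx' := (hS.2 r x hxS).1 hx
    choose y hy using fun i => hsurj _ (hxS i)
    obtain rfl : (fun i => ι (y i).1) = x := funext hy
    have := (he r _).1 (h.map_rel r y ((hXι r _).1 hx'))
    simpa only [hf, Function.comp_apply] using this)
  obtain ⟨f, hf, hrel, hequiv⟩ := exists_fun_of_isHom hg
  have hιX : ∀ y, Mem (ι y) X.carrier := fun y => (hmem _).2 ⟨y, rfl⟩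
  let h : Y → E := fun y => e.symm ⟨f (ι y), hf _ (hιX y)⟩
  have hh : ∀ y, (e (h y)).1 = f (ι y) := fun y => by simp only [h, Equiv.apply_symm_apply]
  refine hE.no_hom ⟨⟨h, fun f => isEmptyElim f, fun r y hy => (he r _).2 ?_⟩, ?_⟩
  · have := hrel r _ ((hXι r y).2 hy)
    simpa only [Function.comp_apply, hh] using this
  · refine F.mem_of_le _ _ g.stabilizer_mem fun γ hγ y => ?_
    refine e.injective (Subtype.ext ?_)
    change (e (h (γ • y))).1 = (e (h y)).1
    rw [hh, hι, hequiv γ hγ _ (hιX y), ← hh]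
    exact smul_eq_of_isPure (isPure_of_mem hpure (e (h y)).2) γ

end PermModel

theorem theorem2p14
    {Γ : Type u} [Group Γ] (F : SubgroupFilter Γ)
    (LE : FirstOrder.Language) [LE.IsRelational] [Finite (Σ n, LE.Relations n)]
    (Y : Type u) [MulAction Γ Y] [LE.Structure Y]
    (E : Type u) [LE.Structure E] (hE : SymmetricCounterexample F LE E Y)
    (LD : FirstOrder.Language) [LD.IsRelational] [Finite (Σ n, LD.Relations n)]
    (D : Type u) [LD.Structure D] (hD : SymmetricallyCompact F LD D) :
    ZFA.IsModel (PermModel F Y) ∧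
      ZFA.KHolds LD D (PermModel F Y) ∧ ZFA.KFails LE E (PermModel F Y) :=
  ⟨PermModel.isModel F Y,
    ⟨PermModel.exists_isCopy F Y LD D, fun _ hB => PermModel.compactness_of_isCopy hD hB⟩,
    ⟨PermModel.exists_isCopy F Y LE E, fun _ hB => PermModel.not_compactness_of_isCopy hE hB⟩⟩
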